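/- Fix integers $d$ and $r$ with $2 \le r \le d$. For $L \ge 1$ let $\mathbb{T}_L^d$ be the $d$-dimensional torus: the graph with node set $\{1,\dots,L\}^d$ in which two distinct nodes are adjacent if and only if they differ in exactly one coordinate, and there by $1$ or $L-1$. In two-way $r$-bootstrap percolation (two-way $r$-BP) every node is black or white, initially each node is independently black with probability $p$ and white with probability $1-p$, and in each discrete round, simultaneously, every node becomes black if it has at least $r$ black neighbours in the current configuration and becomes white otherwise. Theorem 1. Let $p = p(L) \in [0,1]$ satisfy $p(L) = o\bigl(L^{-d/2^{r-1}}\bigr)$ as $L \to \infty$. Then two-way $r$-BP on $\mathbb{T}_L^d$ with initial probability $p(L)$ becomes fully white asymptotically almost surely: the probability that from some round on all nodes are white tends to $1$ as $L \to \infty$. -/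

import Mathlib

open MeasureTheory ProbabilityTheory Filter Topology Asymptotics

/-- A configuration on the node set `V`: every node is black (`true`) or white (`false`). -/
abbrev Config (V : Type*) := V → Bool

/-- The set of black neighbours of `v` in the configuration `C`. -/
def blackNeighbors {V : Type*} (G : SimpleGraph V) (C : Config V) (v : V) : Set V :=
  {u | G.Adj v u ∧ C u = true}

/-- One round of two-way `r`-bootstrap percolation on a finite graph: a node is black after the
round if it had at least `r` black neighbours before it, and white otherwise. -/
noncomputable def twoWayStep {V : Type*} [Finite V] (G : SimpleGraph V) (r : ℕ) (C : Config V) :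
    Config V :=
  fun v => decide (r ≤ (blackNeighbors G C v).ncard)

/-- The configuration after `t` rounds of two-way `r`-bootstrap percolation from `C₀`. -/
noncomputable def twoWayBP {V : Type*} [Finite V] (G : SimpleGraph V) (r : ℕ) (C₀ : Config V) :
    ℕ → Config V
  | 0 => C₀
  | t + 1 => twoWayStep G r (twoWayBP G r C₀ t)

/-- Two-way `r`-bootstrap percolation started from `C₀` becomes fully white: from some round on,
all nodes are white. -/
def BecomesFullyWhite {V : Type*} [Finite V] (G : SimpleGraph V) (r : ℕ) (C₀ : Config V) : Prop :=
  ∃ T : ℕ, ∀ t, T ≤ t → ∀ v, twoWayBP G r C₀ t v = false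

/-- The `d`-dimensional torus: the nodes are the points of a `d`-fold product of `L` consecutive
integers (numbered from `0`), and two distinct nodes are adjacent if and only if they differ in
exactly one coordinate, and there by `1` or by `L - 1`. -/
def torus (L d : ℕ) : SimpleGraph (Fin d → Fin L) where
  Adj x y := x ≠ y ∧ ∃ j, (|((x j : ℕ) : ℤ) - ((y j : ℕ) : ℤ)| = 1 ∨
      |((x j : ℕ) : ℤ) - ((y j : ℕ) : ℤ)| = (L : ℤ) - 1) ∧ ∀ k, k ≠ j → x k = y k
  symm := ⟨by
    rintro x y ⟨hne, j, hj, hk⟩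
    refine ⟨hne.symm, j, ?_, fun k hkj => (hk k hkj).symm⟩
    rwa [abs_sub_comm]⟩
  loopless := ⟨fun _ h => h.1 rfl⟩

/-- The law of the initial random configuration: every node is, independently of the others, black
with probability `p` and white with probability `1 - p`. -/
noncomputable def initialLaw (V : Type*) [Fintype V] (p : unitInterval) : Measure (Config V) :=
  Measure.pi fun _ : V => bernoulliMeasure true false p

/-! A node that is black after `r - 1` rounds forces `2 ^ (r - 1)` initially black nodes within
bounded distance. Indeed, a black node had two distinct black neighbours one round earlier, and some
coordinate hyperplane separates them. Restricting to either half-space costs each point at most one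
neighbour, so `latticeBP_inter_subset` lowers the threshold by one, and the two sides supply
disjoint initial sets: each round doubles the count (`exists_two_pow_black_near`). Half-spaces need
`ℤ ^ d`, so the torus process is lifted to its periodic extension. A union bound then gives failure
probability at most a constant times `L ^ d * p ^ 2 ^ (r - 1)`, which tends to `0`. -/

/-! ### Doubling of black points in the lattice -/

/-- Adjacency in the integer lattice `ℤ ^ d`: the points differ in exactly one coordinate, by `1`. -/
def LatticeAdj {d : ℕ} (x y : Fin d → ℤ) : Prop :=
  ∃ j, |x j - y j| = 1 ∧ ∀ k, k ≠ j → x k = y k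

/-- The black set after `t` rounds of two-way `r`-bootstrap percolation on `ℤ ^ d` from the black
set `A`. -/
def latticeBP {d : ℕ} (r : ℕ) (A : Set (Fin d → ℤ)) : ℕ → Set (Fin d → ℤ)
  | 0 => A
  | t + 1 => {v | ∃ F : Finset (Fin d → ℤ), r ≤ F.card ∧
      ∀ u ∈ F, LatticeAdj v u ∧ u ∈ latticeBP r A t}

/-- If every point of `S` has at most one neighbour outside `S`, then inside `S` the two-way
`(r + 1)`-process from `A` is dominated by the two-way `r`-process from `A ∩ S`. -/
theorem latticeBP_inter_subset {d r : ℕ} {A S : Set (Fin d → ℤ)}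
    (hS : ∀ v ∈ S, ∀ u w, LatticeAdj v u → LatticeAdj v w → u ∉ S → w ∉ S → u = w) (t : ℕ) :
    latticeBP (r + 1) A t ∩ S ⊆ latticeBP r (A ∩ S) t := by
  classical
  induction t with
  | zero => exact fun x hx => hx
  | succ t ih =>
    rintro v ⟨⟨F, hF, hadj⟩, hv⟩
    refine ⟨F.filter (· ∈ S), ?_, fun u hu => ?_⟩
    · have h1 : (F.filter (¬ · ∈ S)).card ≤ 1 := by
        refine Finset.card_le_one.2 fun a ha b hb => ?_
        rw [Finset.mem_filter] at ha hb
        exact hS v hv a b (hadj a ha.1).1 (hadj b hb.1).1 ha.2 hb.2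
      have h2 := Finset.card_filter_add_card_filter_not (s := F) (· ∈ S)
      omega
    · rw [Finset.mem_filter] at hu
      exact ⟨(hadj u hu.1).1, ih ⟨(hadj u hu.1).2, hu.2⟩⟩

theorem LatticeAdj.abs_sub_le {d : ℕ} {x y : Fin d → ℤ} (h : LatticeAdj x y) (i : Fin d) :
    |x i - y i| ≤ 1 := by
  obtain ⟨j, hj, hk⟩ := h
  by_cases hij : i = j
  · rw [hij, hj]
  · simp [hk i hij]

/-- Two lattice neighbours of `v` that agree, and differ from `v`, in some coordinate are equal. -/
theorem LatticeAdj.eq_of_coord {d : ℕ} {v u w : Fin d → ℤ} (hu : LatticeAdj v u)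
    (hw : LatticeAdj v w) {j : Fin d} (huj : v j ≠ u j) (h : u j = w j) : u = w := by
  obtain ⟨a, -, ha⟩ := hu
  obtain ⟨b, -, hb⟩ := hw
  obtain rfl : j = a := by_contra fun hne => huj (ha j hne)
  obtain rfl : j = b := by_contra fun hne => huj (h ▸ hb j hne)
  funext k
  by_cases hk : k = j
  · rw [hk, h]
  · rw [← ha k hk, hb k hk]

/-- Only the unit step in direction `j` across the hyperplane can leave the half-space. -/
theorem halfspace_le_neighbor_unique {d : ℕ} (j : Fin d) (c : ℤ) :
    ∀ v ∈ {x : Fin d → ℤ | x j ≤ c}, ∀ u w, LatticeAdj v u → LatticeAdj v w →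
      u ∉ {x : Fin d → ℤ | x j ≤ c} → w ∉ {x : Fin d → ℤ | x j ≤ c} → u = w := by
  intro v hv u w hu hw hu' hw'
  simp only [Set.mem_ofPred_eq, not_le] at hv hu' hw'
  have h1 := abs_le.1 (hu.abs_sub_le j)
  have h2 := abs_le.1 (hw.abs_sub_le j)
  exact hu.eq_of_coord hw (j := j) (by omega) (by omega)

theorem halfspace_gt_neighbor_unique {d : ℕ} (j : Fin d) (c : ℤ) :
    ∀ v ∈ {x : Fin d → ℤ | c < x j}, ∀ u w, LatticeAdj v u → LatticeAdj v w →
      u ∉ {x : Fin d → ℤ | c < x j} → w ∉ {x : Fin d → ℤ | c < x j} → u = w := by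
  intro v hv u w hu hw hu' hw'
  simp only [Set.mem_ofPred_eq, not_lt] at hv hu' hw'
  have h1 := abs_le.1 (hu.abs_sub_le j)
  have h2 := abs_le.1 (hw.abs_sub_le j)
  exact hu.eq_of_coord hw (j := j) (by omega) (by omega)

/-- A point that is black after `t < r` rounds has at least `2 ^ t` initially black points within
distance `t` in the supremum norm. -/
theorem exists_two_pow_black_near {d : ℕ} (t : ℕ) : ∀ (r : ℕ) (A : Set (Fin d → ℤ))
    (v : Fin d → ℤ), t < r → v ∈ latticeBP r A t →
    ∃ F : Finset (Fin d → ℤ), F.card = 2 ^ t ∧ ∀ u ∈ F, u ∈ A ∧ ∀ i, |u i - v i| ≤ t := by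
  classical
  induction t with
  | zero =>
    intro r A v _ hv
    exact ⟨{v}, by simp, fun u hu => by
      rw [Finset.mem_singleton.1 hu]
      exact ⟨hv, by simp⟩⟩
  | succ t ih =>
    intro r A v hr hv
    obtain ⟨r, rfl⟩ : ∃ s, r = s + 1 := ⟨r - 1, by omega⟩
    obtain ⟨F, hF, hadj⟩ := hv
    obtain ⟨u, hu, w, hw, huw⟩ := Finset.one_lt_card.1 (show 1 < F.card by omega)
    -- Cut between `u` and `w` at `x j = u j`; the induction hypothesis applies on each side, with
    -- threshold `r` and only that side's initial black points.
    have separated : ∀ u ∈ F, ∀ w ∈ F, ∀ j, u j < w j → ∃ F' : Finset (Fin d → ℤ),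
        F'.card = 2 ^ (t + 1) ∧ ∀ x ∈ F', x ∈ A ∧ ∀ i, |x i - v i| ≤ (t + 1 : ℕ) := by
      intro u hu w hw j hj
      obtain ⟨F₁, hc₁, h₁⟩ := ih r _ u (by omega)
        (latticeBP_inter_subset (halfspace_le_neighbor_unique j (u j)) t
          ⟨(hadj u hu).2, le_refl (u j)⟩)
      obtain ⟨F₂, hc₂, h₂⟩ := ih r _ w (by omega)
        (latticeBP_inter_subset (halfspace_gt_neighbor_unique j (u j)) t ⟨(hadj w hw).2, hj⟩)
      have near : ∀ y, LatticeAdj v y → ∀ x : Fin d → ℤ, (∀ i, |x i - y i| ≤ t) →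
          ∀ i, |x i - v i| ≤ (t + 1 : ℕ) := by
        intro y hy x hx i
        have h1 := abs_le.1 (hy.abs_sub_le i)
        have h2 := abs_le.1 (hx i)
        rw [abs_le]
        push_cast
        omega
      refine ⟨F₁ ∪ F₂, ?_, fun x hx => ?_⟩
      · rw [Finset.card_union_of_disjoint, hc₁, hc₂, pow_succ]
        · ring
        · refine Finset.disjoint_left.2 fun x hx₁ hx₂ => ?_
          have hle : x j ≤ u j := (h₁ x hx₁).1.2
          have hlt : u j < x j := (h₂ x hx₂).1.2
          exact absurd hle (not_le.2 hlt)
      · rcases Finset.mem_union.1 hx with hx | hx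
        · exact ⟨(h₁ x hx).1.1, near u (hadj u hu).1 x (h₁ x hx).2⟩
        · exact ⟨(h₂ x hx).1.1, near w (hadj w hw).1 x (h₂ x hx).2⟩
    obtain ⟨j, hj⟩ := Function.ne_iff.1 huw
    rcases lt_or_gt_of_ne hj with h | h
    · exact separated u hu w hw j h
    · exact separated w hw u hu j h

/-! ### Lifting the torus to the lattice -/

/-- Reduction of the integer lattice modulo `L`. -/
def toTorus {L d : ℕ} [NeZero L] (x : Fin d → ℤ) : Fin d → Fin L := fun i =>
  ⟨(x i % L).toNat, by
    have h1 := Int.emod_lt_of_pos (x i) (show (0 : ℤ) < L by exact_mod_cast NeZero.pos L)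
    have h2 := Int.emod_nonneg (x i) (show (L : ℤ) ≠ 0 by exact_mod_cast NeZero.ne L)
    omega⟩

theorem toTorus_apply {L d : ℕ} [NeZero L] (x : Fin d → ℤ) (i : Fin d) :
    (((toTorus x : Fin d → Fin L) i : ℕ) : ℤ) = x i % L :=
  Int.toNat_of_nonneg (Int.emod_nonneg _ (by exact_mod_cast NeZero.ne L))

theorem toTorus_apply_eq_iff {L d : ℕ} [NeZero L] {x y : Fin d → ℤ} {i : Fin d} :
    (toTorus x : Fin d → Fin L) i = toTorus y i ↔ x i % L = y i % L := by
  rw [← toTorus_apply, ← toTorus_apply, Nat.cast_inj, Fin.val_inj]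

theorem toTorus_natCast {L d : ℕ} [NeZero L] (v : Fin d → Fin L) :
    toTorus (fun i => ((v i : ℕ) : ℤ)) = v := by
  funext i
  apply Fin.ext
  have h := toTorus_apply (L := L) (fun i => ((v i : ℕ) : ℤ)) i
  rw [Int.emod_eq_of_lt (by positivity) (by exact_mod_cast (v i).2)] at h
  exact_mod_cast h

/-- Torus edges lift to lattice edges with a prescribed starting point. -/
theorem exists_latticeAdj_of_torus_adj {L d : ℕ} [NeZero L] {x : Fin d → ℤ} {y : Fin d → Fin L}
    (h : (torus L d).Adj (toTorus x) y) : ∃ x', LatticeAdj x x' ∧ toTorus x' = y := by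
  obtain ⟨-, j, hj, hk⟩ := h
  rw [toTorus_apply] at hj
  obtain ⟨s, hs, q, hq⟩ : ∃ s : ℤ, |s| = 1 ∧ ∃ q : ℤ, x j + s = (y j : ℕ) + L * q := by
    have hx := Int.emod_add_mul_ediv (x j) L
    rcases hj with hj | hj
    · refine ⟨(y j : ℕ) - x j % L, by rw [abs_sub_comm, hj], x j / L, by linarith⟩
    -- Wrap-around edge: the lift is a unit step into the adjacent period, so the quotient shifts by
    -- one.
    · rcases (abs_eq_abs (b := (L : ℤ) - 1)).1
        (by rw [hj, abs_of_nonneg (by have := NeZero.pos L; omega)]) with h | h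
      · exact ⟨1, by simp, x j / L + 1, by linarith⟩
      · exact ⟨-1, by simp, x j / L - 1, by linarith⟩
  refine ⟨Function.update x j (x j + s), ⟨j, by simpa using hs, fun k hkj => by simp [hkj]⟩, ?_⟩
  rw [← toTorus_natCast y]
  funext k
  rw [toTorus_apply_eq_iff]
  by_cases hkj : k = j
  · subst hkj
    simp [hq]
  · rw [Function.update_of_ne hkj, ← toTorus_apply, hk k hkj,
      Int.emod_eq_of_lt (by positivity) (by exact_mod_cast (y k).2)]

/-- The torus process is dominated by the lattice process from the periodic extension. -/
theorem mem_latticeBP_of_twoWayBP {L d r : ℕ} [NeZero L] {C : Config (Fin d → Fin L)} (t : ℕ) :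
    ∀ x : Fin d → ℤ, twoWayBP (torus L d) r C t (toTorus x) = true →
      x ∈ latticeBP r {x | C (toTorus x) = true} t := by
  classical
  induction t with
  | zero => exact fun x hx => hx
  | succ t ih =>
    intro x hx
    have hcard : r ≤ (blackNeighbors (torus L d) (twoWayBP (torus L d) r C t)
        (toTorus x)).ncard := by simpa [twoWayBP, twoWayStep] using hx
    set B := blackNeighbors (torus L d) (twoWayBP (torus L d) r C t) (toTorus x)
    have lift : ∀ y : B, ∃ x', LatticeAdj x x' ∧ toTorus x' = y.1 :=
      fun y => exists_latticeAdj_of_torus_adj y.2.1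
    choose f hf hfy using lift
    refine ⟨Finset.univ.image f, ?_, ?_⟩
    · rw [Finset.card_image_of_injective]
      · rwa [Finset.card_univ, ← Nat.card_eq_fintype_card, Nat.card_coe_set_eq]
      -- Reduction modulo `L` is a left inverse of the lift, so no black neighbour is lost.
      · intro a b hab
        apply Subtype.ext
        rw [← hfy a, ← hfy b, hab]
    · simp only [Finset.mem_image, Finset.mem_univ, true_and, forall_exists_index,
        forall_apply_eq_imp_iff]
      intro y
      refine ⟨hf y, ih _ ?_⟩
      rw [hfy]
      exact y.2.2

theorem twoWayBP_eq_false_of_le {V : Type*} [Finite V] {G : SimpleGraph V} {r s : ℕ} (hr : 0 < r)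
    {C : Config V} (h : ∀ v, twoWayBP G r C s v = false) :
    ∀ t, s ≤ t → ∀ v, twoWayBP G r C t v = false := by
  intro t hst
  induction t, hst using Nat.le_induction with
  | base => exact h
  | succ t _ ih =>
    intro v
    have : blackNeighbors G (twoWayBP G r C t) v = ∅ := by
      ext u
      simp [blackNeighbors, ih u]
    simp only [twoWayBP, twoWayStep, this, Set.ncard_empty]
    exact decide_eq_false (by omega)

/-- The cube of integer vectors of supremum norm at most `t`. -/
noncomputable def cube (d t : ℕ) : Finset (Fin d → ℤ) := Fintype.piFinset fun _ => Finset.Icc (-(t : ℤ)) t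

/-- Coordinates in the cube differ by at most `2 * t < L`, so congruent ones are equal. This keeps
the full exponent `2 ^ t` in the union bound. -/
theorem toTorus_injOn_cube {L d t : ℕ} [NeZero L] (hL : 2 * t < L) (x : Fin d → ℤ) :
    Set.InjOn (fun s => (toTorus (x + s) : Fin d → Fin L)) (cube d t) := by
  intro a ha b hb hab
  simp only [cube, Finset.mem_coe, Fintype.mem_piFinset, Finset.mem_Icc] at ha hb
  funext i
  have h := toTorus_apply_eq_iff.1 (congrFun hab i)
  simp only [Pi.add_apply] at h
  have h1 : (L : ℤ) ∣ a i - b i := by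
    have := Int.ModEq.dvd (Int.ModEq.symm h)
    rwa [add_sub_add_left_eq_sub] at this
  have h2 := Int.eq_zero_of_abs_lt_dvd h1 (by
    have := ha i
    have := hb i
    rw [abs_lt]
    omega)
  omega

/-- If the torus process is not fully white after `r - 1` rounds, then some cube contains at least
`2 ^ (r - 1)` initially black nodes. -/
theorem becomesFullyWhite_or_exists_black_cube {L d t : ℕ} [NeZero L]
    (C : Config (Fin d → Fin L)) :
    BecomesFullyWhite (torus L d) (t + 1) C ∨ ∃ v : Fin d → Fin L,
      ∃ S ∈ (cube d t).powersetCard (2 ^ t),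
        ∀ s ∈ S, C (toTorus ((fun i => ((v i : ℕ) : ℤ)) + s)) = true := by
  classical
  by_cases h : ∀ v, twoWayBP (torus L d) (t + 1) C t v = false
  · exact Or.inl ⟨t, twoWayBP_eq_false_of_le (Nat.succ_pos t) h⟩
  · right
    push Not at h
    obtain ⟨v, hv⟩ := h
    rw [Bool.ne_false_iff] at hv
    set x : Fin d → ℤ := fun i => ((v i : ℕ) : ℤ)
    rw [← toTorus_natCast v] at hv
    obtain ⟨F, hF, hblack⟩ := exists_two_pow_black_near t _ _ _ (Nat.lt_succ_self t)
      (mem_latticeBP_of_twoWayBP t _ hv)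
    -- Translating by `-x` makes the number of candidate sets independent of `v` and `L`.
    refine ⟨v, F.image (· - x), ?_, ?_⟩
    · rw [Finset.mem_powersetCard, Finset.card_image_of_injective _ sub_left_injective]
      refine ⟨fun s hs => ?_, hF⟩
      obtain ⟨u, hu, rfl⟩ := Finset.mem_image.1 hs
      simp only [cube, Fintype.mem_piFinset, Finset.mem_Icc, Pi.sub_apply]
      exact fun i => abs_le.1 ((hblack u hu).2 i)
    · intro s hs
      obtain ⟨u, hu, rfl⟩ := Finset.mem_image.1 hs
      rw [add_sub_cancel]
      exact (hblack u hu).1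

/-! ### Union bound and limit -/

instance isProbabilityMeasure_initialLaw (V : Type*) [Fintype V] (p : unitInterval) :
    IsProbabilityMeasure (initialLaw V p) := by
  unfold initialLaw
  infer_instance

/-- The probability that all nodes of `F` are initially black. -/
theorem initialLaw_forall_black {V : Type*} [Fintype V] (p : unitInterval) (F : Finset V) :
    initialLaw V p {C | ∀ u ∈ F, C u = true} = ENNReal.ofReal p ^ F.card := by
  classical
  have : {C : Config V | ∀ u ∈ F, C u = true} =
      Set.univ.pi fun u => if u ∈ F then {true} else Set.univ := by
    ext C
    simp only [Set.mem_ofPred_eq, Set.mem_univ_pi]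
    refine forall_congr' fun u => ?_
    by_cases hu : u ∈ F <;> simp [hu]
  rw [this, initialLaw, Measure.pi_pi, ← Finset.prod_const, ← Finset.prod_subset F.subset_univ]
  · refine Finset.prod_congr rfl fun u hu => ?_
    rw [if_pos hu]
    simp [ENNReal.ofReal, Real.toNNReal_of_nonneg p.2.1, unitInterval.toNNReal]
    rfl
  · intro u _ hu
    rw [if_neg hu, measure_univ]

/-- The union bound for the probability of not becoming fully white. -/
theorem initialLaw_not_becomesFullyWhite_le {L d t : ℕ} (hL : 2 * t < L) (p : unitInterval) :
    initialLaw (Fin d → Fin L) p {C | BecomesFullyWhite (torus L d) (t + 1) C}ᶜ ≤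
      ENNReal.ofReal (((cube d t).card.choose (2 ^ t)) * ((L : ℝ) ^ d * (p : ℝ) ^ 2 ^ t)) := by
  classical
  have : NeZero L := ⟨by omega⟩
  have hsub : {C | BecomesFullyWhite (torus L d) (t + 1) C}ᶜ ⊆
      ⋃ v ∈ (Finset.univ : Finset (Fin d → Fin L)), ⋃ S ∈ (cube d t).powersetCard (2 ^ t),
        {C : Config (Fin d → Fin L) | ∀ u ∈ S.image
          (fun s => toTorus ((fun i => ((v i : ℕ) : ℤ)) + s)), C u = true} := by
    intro C hC
    obtain ⟨v, S, hS, h⟩ := (becomesFullyWhite_or_exists_black_cube C).resolve_left hC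
    simp only [Set.mem_iUnion]
    refine ⟨v, Finset.mem_univ v, S, hS, fun u hu => ?_⟩
    obtain ⟨s, hs, rfl⟩ := Finset.mem_image.1 hu
    exact h s hs
  refine (measure_mono hsub).trans ((measure_biUnion_finset_le _ _).trans
    ((Finset.sum_le_sum fun v _ => measure_biUnion_finset_le _ _).trans (le_of_eq ?_)))
  have hterm : ∀ v : Fin d → Fin L, ∀ S ∈ (cube d t).powersetCard (2 ^ t),
      initialLaw (Fin d → Fin L) p {C | ∀ u ∈ S.image
        (fun s => toTorus ((fun i => ((v i : ℕ) : ℤ)) + s)), C u = true} =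
      ENNReal.ofReal p ^ 2 ^ t := by
    intro v S hS
    rw [Finset.mem_powersetCard] at hS
    rw [initialLaw_forall_black, Finset.card_image_of_injOn, hS.2]
    exact (toTorus_injOn_cube hL _).mono (by exact_mod_cast hS.1)
  rw [Finset.sum_congr rfl fun v _ => Finset.sum_congr rfl (hterm v)]
  have hp := p.2.1
  rw [ENNReal.ofReal_mul (by positivity), ENNReal.ofReal_mul (by positivity),
    ENNReal.ofReal_pow hp, ENNReal.ofReal_pow (by positivity), ENNReal.ofReal_natCast,
    ENNReal.ofReal_natCast]
  simp only [Finset.sum_const, Finset.card_powersetCard, Finset.card_univ, Fintype.card_pi,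
    Fintype.card_fin, Finset.prod_const, nsmul_eq_mul, Nat.cast_pow]
  ring

theorem tendsto_pow_mul_pow_of_isLittleO {d N : ℕ} (hN : N ≠ 0) {p : ℕ → ℝ}
    (hp : p =o[atTop] fun L : ℕ => (L : ℝ) ^ (-((d : ℝ) / N))) :
    Tendsto (fun L : ℕ => (L : ℝ) ^ d * p L ^ N) atTop (𝓝 0) := by
  have h := hp.tendsto_div_nhds_zero.pow N
  rw [zero_pow hN] at h
  refine h.congr fun L => ?_
  have hL : (0 : ℝ) ≤ L := by positivity
  rw [div_pow, ← Real.rpow_natCast _ N, ← Real.rpow_natCast _ N, ← Real.rpow_natCast _ d,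
    ← Real.rpow_mul hL, neg_mul, div_mul_cancel₀ _ (by exact_mod_cast hN), Real.rpow_neg hL,
    div_inv_eq_mul, mul_comm]

theorem theorem1 (d r : ℕ) (hr : 2 ≤ r) (hrd : r ≤ d) (p : ℕ → unitInterval)
    (hp : (fun L : ℕ => (p L : ℝ)) =o[atTop]
      (fun L : ℕ => (L : ℝ) ^ (-((d : ℝ) / (2 : ℝ) ^ (r - 1))))) :
    Tendsto
      (fun L : ℕ => initialLaw (Fin d → Fin L) (p L) {C₀ | BecomesFullyWhite (torus L d) r C₀})
      atTop (𝓝 1) := by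
  obtain ⟨t, rfl⟩ : ∃ t, r = t + 1 := ⟨r - 1, by omega⟩
  have hp' : (fun L : ℕ => (p L : ℝ)) =o[atTop]
      fun L : ℕ => (L : ℝ) ^ (-((d : ℝ) / (2 ^ t : ℕ))) := by simpa using hp
  have hreal := (tendsto_pow_mul_pow_of_isLittleO (by positivity) hp').const_mul
    ((cube d t).card.choose (2 ^ t) : ℝ)
  rw [mul_zero] at hreal
  have hbad := ENNReal.tendsto_ofReal hreal
  rw [ENNReal.ofReal_zero] at hbad
  have hlow := ENNReal.Tendsto.sub (tendsto_const_nhds (x := (1 : ENNReal))) hbad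
    (Or.inl ENNReal.one_ne_top)
  rw [tsub_zero] at hlow
  refine tendsto_of_tendsto_of_tendsto_of_le_of_le' hlow tendsto_const_nhds ?_
    (Eventually.of_forall fun L => prob_le_one)
  filter_upwards [eventually_gt_atTop (2 * t)] with L hL
  -- Subadditivity over an event and its complement suffices, so measurability is not needed.
  rw [tsub_le_iff_right, ← measure_univ (μ := initialLaw (Fin d → Fin L) (p L)),
    ← Set.union_compl_self {C₀ | BecomesFullyWhite (torus L d) (t + 1) C₀}]
  exact (measure_union_le _ _).trans
    (add_le_add_right (initialLaw_not_becomesFullyWhite_le hL (p L)) _)
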